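/- Let $S$ be a closed smooth surface, that is, a compact Hausdorff smooth $2$-manifold without boundary (not necessarily connected or orientable), and let $f\colon S\to\mathbb{R}^3$ be a smooth immersion (for instance, the inclusion of a closed surface $S\subset\mathbb{R}^3$). Let $\gamma\colon\mathbb{R}\to\mathbb{R}^3$ be a smooth closed curve, that is, a $C^\infty$ map with $\gamma(t+1)=\gamma(t)$ for all $t$; it may intersect itself. Suppose that $\gamma$ and $f$ are transverse: whenever $\gamma(t)=f(x)$, one has $\mathbb{R}\,\gamma'(t)+df_x(T_xS)=\mathbb{R}^3$. Then the number of intersections of the curve and the surface is finite and even, i.e. the set $$\{(t,x)\in[0,1)\times S : \gamma(t)=f(x)\}$$ is finite and has an even number of elements. Moreover, if distinct pairs $(t,x)$ of this set give distinct points $f(x)$ of $\mathbb{R}^3$ (in particular, if $f$ is an embedding and $\gamma$ is a simple closed curve), then the set of points $\gamma(\mathbb{R})\cap f(S)\subset\mathbb{R}^3$ is finite and has an even number of elements. -/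

import Mathlib

/-!
Near each point of its image, `f` consists of finitely many sheets, each of which has two sides,
and the product over these sheets of the sign of the side is a sign function which is canonical up
to a global sign. The two choices at every point form a double cover of `ℝ³`, which has a section
because `ℝ³` is simply connected: this is a global function `s` changing sign across each sheet.
Along the curve, `s ∘ γ` is periodic and near every `t` it agrees up to sign with
`∏ sign (r - t)`, the product being over the crossings at `t`. The sign of
`∏ sin (π (r - tᵢ) / c)`, over all crossings `tᵢ` in one period `c`, has the same germs up to sign,
so it differs from `s ∘ γ` by a constant. But the shift by `c` multiplies it by `(-1) ^ m`, where
`m` is the number of crossings, hence `m` is even.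
-/

open Set Manifold
open scoped ContDiff

/-- A smooth closed curve in `ℝ³`, parametrised with period `1`; self-intersections are allowed. -/
structure IsSmoothClosedCurve (γ : ℝ → EuclideanSpace ℝ (Fin 3)) : Prop where
  contDiff : ContDiff ℝ ∞ γ
  periodic : Function.Periodic γ 1

section

variable {S : Type*} [TopologicalSpace S] [ChartedSpace (EuclideanSpace ℝ (Fin 2)) S]

/-- The pairs `(t, x)` of a parameter of the closed curve `γ`, taken in one period, and a point of
the surface `S` which `γ` and `f : S → ℝ³` send to the same point of `ℝ³`. -/
def intersectionPairs (γ : ℝ → EuclideanSpace ℝ (Fin 3)) (f : S → EuclideanSpace ℝ (Fin 3)) :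
    Set (ℝ × S) :=
  {p | p.1 ∈ Ico (0 : ℝ) 1 ∧ γ p.1 = f p.2}

/-- The curve `γ` and the surface `f : S → ℝ³` are transverse: wherever they meet, the tangent line
of the curve and the tangent plane of the surface together span `ℝ³`. -/
def CurveTransverse (γ : ℝ → EuclideanSpace ℝ (Fin 3)) (f : S → EuclideanSpace ℝ (Fin 3)) : Prop :=
  ∀ (t : ℝ) (x : S), γ t = f x →
    Submodule.span ℝ {deriv γ t} ⊔
      LinearMap.range (mfderiv (𝓡 2) 𝓘(ℝ, EuclideanSpace ℝ (Fin 3)) f x :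
        EuclideanSpace ℝ (Fin 2) →L[ℝ] EuclideanSpace ℝ (Fin 3)).toLinearMap = ⊤

end

open Filter Function Topology SignType

section SignGerm

variable {X Y ι : Type*} [TopologicalSpace X] [TopologicalSpace Y]

theorem signUnits_eq_or_eq_neg (a b : SignTypeˣ) : a = b ∨ a = -b := by
  revert a b; decide

theorem signUnits_neg_ne_self : ∀ a : SignTypeˣ, -a ≠ a := by
  decide

theorem exists_signUnits_eq {a : SignType} (ha : a ≠ 0) : ∃ c : SignTypeˣ, (c : SignType) = a :=
  ⟨Units.mk0 a ha, rfl⟩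

/-- Two sign functions agree near `q` up to a global sign. -/
def SignGermEq (s s' : X → SignType) (q : X) : Prop :=
  ∃ c : SignTypeˣ, ∀ᶠ z in 𝓝 q, s z = c * s' z

namespace SignGermEq

variable {s s' s'' : X → SignType} {q : X}

theorem symm (h : SignGermEq s s' q) : SignGermEq s' s q := by
  obtain ⟨c, h⟩ := h
  exact ⟨c⁻¹, h.mono fun z hz => by rw [hz, Units.inv_mul_cancel_left]⟩

theorem trans (h : SignGermEq s s' q) (h' : SignGermEq s' s'' q) : SignGermEq s s'' q := by
  obtain ⟨c, h⟩ := h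
  obtain ⟨d, h'⟩ := h'
  refine ⟨c * d, ?_⟩
  filter_upwards [h, h'] with z hz hz'
  rw [hz, hz', Units.val_mul, mul_assoc]

theorem comp {g : Y → X} {y : Y} (h : SignGermEq s s' (g y)) (hg : ContinuousAt g y) :
    SignGermEq (s ∘ g) (s' ∘ g) y :=
  h.imp fun _ hc => hg.eventually hc

theorem prod {t : Finset ι} {u v : ι → X → SignType} (h : ∀ i ∈ t, SignGermEq (u i) (v i) q) :
    SignGermEq (fun z => ∏ i ∈ t, u i z) (fun z => ∏ i ∈ t, v i z) q := by
  choose! c hc using h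
  refine ⟨∏ i ∈ t, c i, ?_⟩
  filter_upwards [(Finset.eventually_all t).2 hc] with z hz
  rw [Finset.prod_congr rfl hz, Finset.prod_mul_distrib, Units.coe_prod]

theorem frequently_ne_zero (h : SignGermEq s s' q) (hne : ∃ᶠ z in 𝓝 q, s' z ≠ 0) :
    ∃ᶠ z in 𝓝 q, s z ≠ 0 := by
  obtain ⟨c, hc⟩ := h
  refine (hne.and_eventually hc).mono fun z hz => ?_
  rw [hz.2]
  exact mul_ne_zero c.ne_zero hz.1

theorem factor_unique (hne : ∃ᶠ z in 𝓝 q, s' z ≠ 0) {c d : SignTypeˣ}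
    (hc : ∀ᶠ z in 𝓝 q, s z = c * s' z) (hd : ∀ᶠ z in 𝓝 q, s z = d * s' z) : c = d := by
  obtain ⟨z, hz, hcz, hdz⟩ := (hne.and_eventually (hc.and hd)).exists
  exact Units.ext (mul_right_cancel₀ hz (hcz.symm.trans hdz))

theorem exists_forall_eq_mul [PreconnectedSpace X] (h : ∀ q, SignGermEq s s' q)
    (hne : ∀ q, ∃ᶠ z in 𝓝 q, s' z ≠ 0) : ∃ c : SignTypeˣ, ∀ z, s z = c * s' z := by
  choose c hc using h
  have hloc : IsLocallyConstant c := (IsLocallyConstant.iff_eventually_eq c).2 fun q =>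
    (hc q).eventually_nhds.mono fun q' hq' => factor_unique (hne q') (hc q') hq'
  obtain hX | ⟨⟨q₀⟩⟩ := isEmpty_or_nonempty X
  · exact ⟨1, hX.elim⟩
  · exact ⟨c q₀, fun z => by rw [← hloc.apply_eq_of_preconnectedSpace z q₀, (hc z).self_of_nhds]⟩

end SignGermEq

theorem signGermEq_one_of_continuousAt {h : X → ℝ} {x : X} (hc : ContinuousAt h x) (hne : h x ≠ 0) :
    SignGermEq (fun z => sign (h z)) (fun _ => 1) x := by
  obtain ⟨c, hc'⟩ := exists_signUnits_eq (sign_ne_zero.2 hne)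
  refine ⟨c, ?_⟩
  have := (continuousAt_sign_of_ne_zero hne).comp hc
  filter_upwards [this.eventually (isOpen_discrete {sign (h x)} |>.mem_nhds rfl)] with z hz
  rw [mul_one, hc']
  exact hz

theorem signGermEq_sub_of_hasDerivAt {h : ℝ → ℝ} {h' t : ℝ} (hd : HasDerivAt h h' t)
    (h0 : h t = 0) (hne : h' ≠ 0) :
    SignGermEq (fun s => sign (h s)) (fun s => sign (s - t)) t := by
  have hslope : ContinuousAt (Function.update (slope h t) t h') t :=
    continuousAt_update_same.2 (hasDerivAt_iff_tendsto_slope.1 hd)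
  obtain ⟨c, hc⟩ := signGermEq_one_of_continuousAt hslope (by simpa using hne)
  refine ⟨c, hc.mono fun s hs => ?_⟩
  obtain rfl | hst := eq_or_ne s t
  · simp [h0]
  · simp only [Function.update_of_ne hst, mul_one] at hs
    rw [← hs, ← sign_mul, slope_def_field, h0, sub_zero, div_mul_cancel₀ _ (sub_ne_zero.2 hst)]

end SignGerm

section Gluing

variable {X : Type*} [TopologicalSpace X]

/-- A sign germ `σ p` at every point `p`, consistent up to sign with the germs at nearby points. The
global sign functions inducing `σ` are the sections of a double cover of `X`. -/
structure IsSignSystem (σ : X → X → SignType) : Prop where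
  eventually_signGermEq (p : X) : ∀ᶠ q in 𝓝 p, SignGermEq (σ p) (σ q) q
  frequently_ne_zero (p : X) : ∃ᶠ z in 𝓝 p, σ p z ≠ 0

open Classical in
/-- The sign relating `s` to `s'` near `q`, with value `1` if there is none. -/
noncomputable def signFactor (s s' : X → SignType) (q : X) : SignTypeˣ :=
  if h : SignGermEq s s' q then h.choose else 1

theorem SignGermEq.eventually_eq_signFactor_mul {s s' : X → SignType} {q : X}
    (h : SignGermEq s s' q) : ∀ᶠ z in 𝓝 q, s z = signFactor s s' q * s' z := by
  rw [signFactor, dif_pos h]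
  exact h.choose_spec

theorem signFactor_eq {s s' : X → SignType} {q : X} {c : SignTypeˣ}
    (hne : ∃ᶠ z in 𝓝 q, s' z ≠ 0) (hc : ∀ᶠ z in 𝓝 q, s z = c * s' z) : signFactor s s' q = c :=
  SignGermEq.factor_unique hne (SignGermEq.eventually_eq_signFactor_mul ⟨c, hc⟩) hc

namespace IsSignSystem

variable {σ : X → X → SignType} (hσ : IsSignSystem σ)
include hσ

theorem eventually_signFactor_eq {i j b : X} (hi : SignGermEq (σ i) (σ b) b)
    (hj : ∀ᶠ q in 𝓝 b, SignGermEq (σ j) (σ q) q) :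
    ∀ᶠ q in 𝓝 b, signFactor (σ i) (σ j) q = signFactor (σ i) (σ j) b := by
  filter_upwards [hj,
    (hi.trans hj.self_of_nhds.symm).eventually_eq_signFactor_mul.eventually_nhds] with q hjq hq
  exact signFactor_eq (hjq.frequently_ne_zero (hσ.frequently_ne_zero _)) hq

theorem signFactor_eq_mul {i j k b : X} (hi : SignGermEq (σ i) (σ b) b)
    (hj : SignGermEq (σ j) (σ b) b) (hk : SignGermEq (σ k) (σ b) b) :
    signFactor (σ i) (σ k) b = signFactor (σ i) (σ j) b * signFactor (σ j) (σ k) b := by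
  refine signFactor_eq (hk.frequently_ne_zero (hσ.frequently_ne_zero _)) ?_
  filter_upwards [(hi.trans hj.symm).eventually_eq_signFactor_mul,
    (hj.trans hk.symm).eventually_eq_signFactor_mul] with z hij hjk
  rw [hij, hjk, Units.val_mul, mul_assoc]

/-- The double cover whose fibre over `q` consists of the two signs of the germ `σ q`. -/
noncomputable def doubleCover : FiberBundleCore X X SignTypeˣ where
  baseSet i := {b | ∀ᶠ q in 𝓝 b, SignGermEq (σ i) (σ q) q}
  isOpen_baseSet _ := isOpen_setOfPred_eventually_nhds
  indexAt := id
  mem_baseSet_at i := hσ.eventually_signGermEq i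
  coordChange i j b v := signFactor (σ i) (σ j) b * v
  coordChange_self i b hb v := by
    have hi : ∀ᶠ q in 𝓝 b, SignGermEq (σ i) (σ q) q := hb
    have hii : signFactor (σ i) (σ i) b = 1 :=
      signFactor_eq (hi.self_of_nhds.frequently_ne_zero (hσ.frequently_ne_zero _)) (by simp)
    rw [hii, one_mul]
  continuousOn_coordChange i j := by
    rintro ⟨b, v⟩ ⟨⟨hi, hj⟩, -⟩
    have hconst := hσ.eventually_signFactor_eq hi.self_of_nhds hj
    have hcont : ContinuousAt (signFactor (σ i) (σ j)) b :=
      continuousAt_const.congr (hconst.mono fun _ h => h.symm)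
    exact (hcont.fst'.mul continuousAt_snd).continuousWithinAt
  coordChange_comp := by
    rintro i j k b ⟨⟨hi, hj⟩, hk⟩ v
    rw [hσ.signFactor_eq_mul hi.self_of_nhds hj.self_of_nhds hk.self_of_nhds, mul_left_comm,
      mul_assoc]

theorem exists_signGermEq [SimplyConnectedSpace X] [LocallyPathConnectedSpace X] :
    ∃ s : X → SignType, ∀ q, SignGermEq s (σ q) q := by
  obtain ⟨x₀⟩ : Nonempty X := inferInstance
  have hcov : IsCoveringMap (Bundle.TotalSpace.proj : hσ.doubleCover.TotalSpace → X) :=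
    FiberBundle.isCoveringMap
  obtain ⟨F, ⟨-, hF⟩, -⟩ := hcov.existsUnique_continuousMap_lifts (ContinuousMap.id X) x₀
    ⟨x₀, (1 : SignTypeˣ)⟩ rfl
  have hproj (q : X) : (F q).1 = q := congrFun hF q
  let v (q : X) : SignTypeˣ := (F q).2
  refine ⟨fun q => v q * σ q q, fun i => ?_⟩
  let e (q : X) : SignTypeˣ := signFactor (σ q) (σ i) q * v q
  have he : ContinuousAt e i := by
    have hmem : F i ∈ (hσ.doubleCover.localTriv i).source := by
      rw [FiberBundleCore.mem_localTriv_source, hproj]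
      exact hσ.doubleCover.mem_baseSet_at i
    have hcont := continuous_snd.continuousAt.comp
      (((hσ.doubleCover.localTriv i).continuousAt hmem).comp F.continuous.continuousAt)
    refine hcont.congr (Eventually.of_forall fun q => ?_)
    change signFactor (σ (F q).1) (σ i) (F q).1 * v q = e q
    rw [hproj]
  refine ⟨e i, ?_⟩
  filter_upwards [hσ.eventually_signGermEq i, he.eventually (mem_nhds_discrete.2 rfl)] with z hz hez
  rw [hez, hz.symm.eventually_eq_signFactor_mul.self_of_nhds, Units.val_mul,
    mul_left_comm, mul_assoc]

end IsSignSystem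

end Gluing

section Parity

open Real

variable {ι : Type*} {c : ℝ}

theorem sin_pi_mul_div_eq_zero_iff (hc : c ≠ 0) (t a : ℝ) :
    sin (π * ((t - a) / c)) = 0 ↔ t ≡ a [PMOD c] := by
  rw [sin_eq_zero_iff, AddCommGroup.modEq_comm, AddCommGroup.modEq_iff_zsmul]
  refine exists_congr fun n => ?_
  rw [zsmul_eq_mul, mul_comm, mul_right_inj' pi_ne_zero, eq_div_iff hc]

open scoped Classical in
theorem signGermEq_sin (hc : c ≠ 0) (a t : ℝ) :
    SignGermEq (fun s => sign (sin (π * ((s - a) / c))))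
      (fun s => if t ≡ a [PMOD c] then sign (s - t) else 1) t := by
  by_cases h0 : sin (π * ((t - a) / c)) = 0
  · have hd : HasDerivAt (fun s => sin (π * ((s - a) / c)))
        (cos (π * ((t - a) / c)) * (π * (1 / c))) t :=
      ((((hasDerivAt_id t).sub_const a).div_const c).const_mul π).sin
    have hcos : cos (π * ((t - a) / c)) ≠ 0 := fun hcos => by
      simpa [h0, hcos] using sin_sq_add_cos_sq (π * ((t - a) / c))
    simpa only [(sin_pi_mul_div_eq_zero_iff hc t a).1 h0, if_true] using
      signGermEq_sub_of_hasDerivAt hd h0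
        (mul_ne_zero hcos (mul_ne_zero pi_ne_zero (one_div_ne_zero hc)))
  · simpa only [mt (sin_pi_mul_div_eq_zero_iff hc t a).2 h0, if_false] using
      signGermEq_one_of_continuousAt (h := fun s => sin (π * ((s - a) / c))) (by fun_prop) h0

open scoped Classical in
theorem even_card_of_periodic_of_signGermEq {g : ℝ → SignType} (hc : c ≠ 0) (hg : Periodic g c)
    (P : Finset ι) (a : ι → ℝ)
    (h : ∀ t, SignGermEq g (fun s => ∏ i ∈ P, if t ≡ a i [PMOD c] then sign (s - t) else 1) t) :
    Even P.card := by
  let G (s : ℝ) : SignType := ∏ i ∈ P, sign (sin (π * ((s - a i) / c)))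
  have hsin (t : ℝ) :
      SignGermEq G (fun s => ∏ i ∈ P, if t ≡ a i [PMOD c] then sign (s - t) else 1) t :=
    SignGermEq.prod fun i _ => signGermEq_sin hc (a i) t
  have hne (t : ℝ) : ∃ᶠ s in 𝓝 t, G s ≠ 0 := by
    refine (hsin t).frequently_ne_zero (Frequently.filter_mono (Eventually.frequently ?_)
      (nhdsWithin_le_nhds (s := {t}ᶜ)))
    filter_upwards [self_mem_nhdsWithin] with s hs
    refine Finset.prod_ne_zero_iff.2 fun i _ => ?_
    split_ifs
    exacts [sign_ne_zero.2 (sub_ne_zero.2 hs), one_ne_zero]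
  obtain ⟨e, he⟩ := SignGermEq.exists_forall_eq_mul (fun t => (h t).trans (hsin t).symm) hne
  have hshift (s : ℝ) : G (s + c) = (-1) ^ P.card * G s := by
    rw [← Finset.prod_const, ← Finset.prod_mul_distrib]
    refine Finset.prod_congr rfl fun i _ => ?_
    rw [show π * ((s + c - a i) / c) = π * ((s - a i) / c) + π by field_simp; ring, sin_add_pi,
      Left.sign_neg, neg_one_mul]
  obtain ⟨s, hs⟩ := (hne 0).exists
  have hgs : e * ((-1) ^ P.card * G s) = e * G s := by rw [← hshift, ← he, ← he, hg]
  exact (neg_one_pow_eq_one_iff_even (by decide)).1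
    ((mul_eq_right₀ hs).1 (mul_left_cancel₀ e.ne_zero hgs))

end Parity

section Bicollar

variable {S N : Type*} [TopologicalSpace S] [TopologicalSpace N]

/-- `Φ` is a chart of `N` by `S × ℝ` around `f x` in which `f` is the inclusion of the zero section.
It need not contain the points of `f` far from `x` in `S`, even when they are mapped close to
`f x`. -/
structure IsBicollarAt (f : S → N) (Φ : OpenPartialHomeomorph (S × ℝ) N) (x : S) : Prop where
  mem_source : (x, 0) ∈ Φ.source
  apply_zero : ∀ y, (y, 0) ∈ Φ.source → Φ (y, 0) = f y

/-- The signed height over `S` in the chart `Φ`; it is meaningful on `Φ.target` only. -/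
def bicollarHeight (Φ : OpenPartialHomeomorph (S × ℝ) N) (z : N) : ℝ := (Φ.symm z).2

theorem map_bicollarHeight_nhds {Φ : OpenPartialHomeomorph (S × ℝ) N} {z : N} (hz : z ∈ Φ.target) :
    map (bicollarHeight Φ) (𝓝 z) = 𝓝 (bicollarHeight Φ z) := by
  rw [show bicollarHeight Φ = Prod.snd ∘ Φ.symm from rfl, ← map_map, Φ.symm.map_nhds_eq hz,
    map_snd_nhds, comp_apply]

theorem continuousAt_bicollarHeight {Φ : OpenPartialHomeomorph (S × ℝ) N} {z : N}
    (hz : z ∈ Φ.target) : ContinuousAt (bicollarHeight Φ) z :=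
  (map_bicollarHeight_nhds hz).le

theorem frequently_bicollarHeight {Φ : OpenPartialHomeomorph (S × ℝ) N} {z : N}
    (hz : z ∈ Φ.target) {p : ℝ → Prop} (hp : ∃ᶠ r in 𝓝 (bicollarHeight Φ z), p r) :
    ∃ᶠ w in 𝓝 z, p (bicollarHeight Φ w) := by
  rwa [← map_bicollarHeight_nhds hz, frequently_map] at hp

namespace IsBicollarAt

variable {f : S → N} {Φ Ψ : OpenPartialHomeomorph (S × ℝ) N} {x : S}

theorem of_mem (hΦ : IsBicollarAt f Φ x) {y : S} (hy : (y, 0) ∈ Φ.source) : IsBicollarAt f Φ y :=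
  ⟨hy, hΦ.apply_zero⟩

theorem eventually (hΦ : IsBicollarAt f Φ x) : ∀ᶠ y in 𝓝 x, IsBicollarAt f Φ y := by
  have hcont : ContinuousAt (fun y : S => (y, (0 : ℝ))) x := by fun_prop
  exact (hcont.eventually (Φ.open_source.eventually_mem hΦ.mem_source)).mono fun _ => hΦ.of_mem

theorem mem_target (hΦ : IsBicollarAt f Φ x) : f x ∈ Φ.target :=
  hΦ.apply_zero x hΦ.mem_source ▸ Φ.map_source hΦ.mem_source

theorem symm_apply (hΦ : IsBicollarAt f Φ x) : Φ.symm (f x) = (x, 0) := by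
  rw [← hΦ.apply_zero x hΦ.mem_source, Φ.left_inv hΦ.mem_source]

theorem height_apply (hΦ : IsBicollarAt f Φ x) : bicollarHeight Φ (f x) = 0 := by
  rw [bicollarHeight, hΦ.symm_apply]

theorem eq_of_apply_eq {y : S} (hx : IsBicollarAt f Φ x) (hy : IsBicollarAt f Φ y)
    (hxy : f x = f y) : x = y := by
  have h := congrArg Φ.symm hxy
  rw [hx.symm_apply, hy.symm_apply] at h
  exact congrArg Prod.fst h

theorem continuousAt (hΦ : IsBicollarAt f Φ x) : ContinuousAt f x := by
  have hcont : ContinuousAt (fun y => Φ (y, 0)) x :=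
    (Φ.continuousAt hΦ.mem_source).comp (f := fun y => (y, (0 : ℝ))) (by fun_prop)
  exact hcont.congr (hΦ.eventually.mono fun y hy => hy.apply_zero y hy.mem_source)

theorem map_nhds (hΦ : IsBicollarAt f Φ x) : map Φ (𝓝 (x, 0)) = 𝓝 (f x) := by
  rw [Φ.map_nhds_eq hΦ.mem_source, hΦ.apply_zero x hΦ.mem_source]

theorem mem_image_of_height_eq_zero (hΦ : IsBicollarAt f Φ x) {V : Set S} (hV : V ∈ 𝓝 x) :
    ∀ᶠ z in 𝓝 (f x), bicollarHeight Φ z = 0 → z ∈ f '' V := by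
  have hfst : ContinuousAt (fun z => (Φ.symm z).1) (f x) :=
    (Φ.symm.continuousAt hΦ.mem_target).fst
  have hV' : V ∈ 𝓝 (Φ.symm (f x)).1 := by rwa [hΦ.symm_apply]
  filter_upwards [hfst.preimage_mem_nhds hV', Φ.open_target.mem_nhds hΦ.mem_target] with z hz hzt h0
  have heq : Φ.symm z = ((Φ.symm z).1, 0) := Prod.ext rfl h0
  refine ⟨(Φ.symm z).1, hz, ?_⟩
  rw [← hΦ.apply_zero _ (heq ▸ Φ.map_target hzt), ← heq, Φ.right_inv hzt]

theorem height_comp_eq_zero_iff (hΦ : IsBicollarAt f Φ x) (hΨ : IsBicollarAt f Ψ x) :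
    ∀ᶠ p in 𝓝 (x, 0), bicollarHeight Ψ (Φ p) = 0 ↔ p.2 = 0 := by
  have hzero := hΨ.mem_image_of_height_eq_zero hΦ.eventually
  rw [← hΦ.map_nhds, eventually_map] at hzero
  filter_upwards [hzero, Φ.open_source.mem_nhds hΦ.mem_source,
    continuousAt_fst.eventually hΨ.eventually] with p hp hpΦ hpΨ
  refine ⟨fun h => ?_, fun h => ?_⟩
  · obtain ⟨y, hy, hyp⟩ := hp h
    have hyp' := congrArg Φ.symm hyp
    rw [hy.symm_apply, Φ.left_inv hpΦ] at hyp'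
    rw [← hyp']
  · obtain ⟨y, r⟩ := p
    obtain rfl : r = 0 := h
    rw [hΦ.apply_zero y hpΦ, hpΨ.height_apply]

end IsBicollarAt

theorem frequently_sign_eq (c : SignTypeˣ) : ∃ᶠ r in 𝓝 (0 : ℝ), sign r = c := by
  obtain rfl | rfl := signUnits_eq_or_eq_neg c 1
  · exact (frequently_gt_nhds 0).mono fun _ => sign_pos
  · exact (frequently_lt_nhds 0).mono fun _ => sign_neg

theorem exists_sign_eq_of_isPreconnected {s : Set S} (hs : IsPreconnected s) {k : S → ℝ}
    (hk : ContinuousOn k s) (hne : ∀ p ∈ s, k p ≠ 0) :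
    ∃ c : SignTypeˣ, ∀ p ∈ s, sign (k p) = c := by
  obtain rfl | ⟨p₀, hp₀⟩ := s.eq_empty_or_nonempty
  · exact ⟨1, by simp⟩
  obtain ⟨c, hc⟩ := exists_signUnits_eq (sign_ne_zero.2 (hne p₀ hp₀))
  have hsign : ContinuousOn (fun p => sign (k p)) s := fun p hp =>
    (continuousAt_sign_of_ne_zero (hne p hp)).comp_continuousWithinAt (hk p hp)
  exact ⟨c, fun p hp => (hs.constant hsign hp hp₀).trans hc.symm⟩

theorem exists_isPreconnected_prod_Ioo_subset [LocallyConnectedSpace S] {x : S} {A : Set (S × ℝ)}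
    (hA : A ∈ 𝓝 (x, 0)) :
    ∃ C ∈ 𝓝 x, IsPreconnected C ∧ ∃ r > 0, C ×ˢ Ioo (-r) r ⊆ A := by
  obtain ⟨u, hu, v, hv, huv⟩ := mem_nhds_prod_iff.1 hA
  obtain ⟨C, ⟨hCo, hxC, hC⟩, hCu⟩ := (LocallyConnectedSpace.open_connected_basis x).mem_iff.1 hu
  obtain ⟨r, hr, hrv⟩ := Metric.mem_nhds_iff.1 hv
  refine ⟨C, hCo.mem_nhds hxC, hC.isPreconnected, r, hr, (prod_mono hCu ?_).trans huv⟩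
  rwa [Real.ball_eq_Ioo, zero_sub, zero_add] at hrv

theorem signGermEq_snd [LocallyConnectedSpace S] {x : S} {k : S × ℝ → ℝ}
    (hcont : ∀ᶠ p in 𝓝 (x, 0), ContinuousAt k p) (hzero : ∀ᶠ p in 𝓝 (x, 0), k p = 0 ↔ p.2 = 0)
    (hfreq : ∀ c : SignTypeˣ, ∃ᶠ p in 𝓝 (x, 0), sign (k p) = c) :
    SignGermEq (fun p => sign (k p)) (fun p => sign p.2) (x, 0) := by
  obtain ⟨C, hCx, hC, r, hr, hbox⟩ := exists_isPreconnected_prod_Ioo_subset (hcont.and hzero)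
  have hbox' : C ×ˢ Ioo (-r) r ∈ 𝓝 (x, 0) :=
    prod_mem_nhds hCx (Ioo_mem_nhds (neg_lt_zero.2 hr) hr)
  have hconst {a b : ℝ} (hab : Ioo a b ⊆ Ioo (-r) r) (h0 : ∀ t ∈ Ioo a b, t ≠ 0) :
      ∃ c : SignTypeˣ, ∀ p ∈ C ×ˢ Ioo a b, sign (k p) = c :=
    have hsub := (prod_mono_right hab).trans hbox
    exists_sign_eq_of_isPreconnected (hC.prod isPreconnected_Ioo)
      (fun p hp => (hsub hp).1.continuousWithinAt) fun p hp => mt (hsub hp).2.1 (h0 p.2 hp.2)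
  obtain ⟨c, hpos⟩ := hconst (Ioo_subset_Ioo_left (neg_lt_zero.2 hr).le) fun t ht => ht.1.ne'
  obtain ⟨d, hneg⟩ := hconst (Ioo_subset_Ioo_right hr.le) fun t ht => ht.2.ne
  have hcd : d = -c := by
    refine (signUnits_eq_or_eq_neg d c).resolve_left ?_
    rintro rfl
    obtain ⟨p, hp, hpC, hpr⟩ := ((hfreq (-d)).and_eventually hbox').exists
    have hk0 : sign (k p) ≠ 0 := hp ▸ (-d).ne_zero
    have hd : sign (k p) = d := by
      obtain h | h | h := lt_trichotomy p.2 0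
      · exact hneg p ⟨hpC, hpr.1, h⟩
      · exact absurd (sign_eq_zero_iff.2 ((hbox ⟨hpC, hpr⟩).2.2 h)) hk0
      · exact hpos p ⟨hpC, h, hpr.2⟩
    exact signUnits_neg_ne_self d (Units.ext (hp.symm.trans hd))
  refine ⟨c, mem_of_superset hbox' ?_⟩
  rintro p ⟨hpC, hpr⟩
  change sign (k p) = c * sign p.2
  obtain h | h | h := lt_trichotomy p.2 0
  · rw [hneg p ⟨hpC, hpr.1, h⟩, hcd, sign_neg h, Units.val_neg, mul_neg_one]
  · rw [(hbox ⟨hpC, hpr⟩).2.2 h, h, sign_zero, mul_zero]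
  · rw [hpos p ⟨hpC, h, hpr.2⟩, sign_pos h, mul_one]

theorem IsBicollarAt.signGermEq [LocallyConnectedSpace S] {f : S → N} {x : S}
    {Φ Ψ : OpenPartialHomeomorph (S × ℝ) N} (hΦ : IsBicollarAt f Φ x) (hΨ : IsBicollarAt f Ψ x) :
    SignGermEq (fun z => sign (bicollarHeight Φ z)) (fun z => sign (bicollarHeight Ψ z)) (f x) := by
  have hcont : ∀ᶠ p in 𝓝 (x, 0), ContinuousAt (fun p => bicollarHeight Ψ (Φ p)) p := by
    have hΨt : ∀ᶠ p in 𝓝 (x, 0), Φ p ∈ Ψ.target := by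
      rw [← eventually_map (P := (· ∈ Ψ.target)), hΦ.map_nhds]
      exact Ψ.open_target.mem_nhds hΨ.mem_target
    filter_upwards [hΨt, Φ.open_source.mem_nhds hΦ.mem_source] with p hp hpΦ
    exact (continuousAt_bicollarHeight hp).comp (Φ.continuousAt hpΦ)
  have hfreq (c : SignTypeˣ) : ∃ᶠ p in 𝓝 (x, 0), sign (bicollarHeight Ψ (Φ p)) = c := by
    have h := frequently_bicollarHeight hΨ.mem_target (hΨ.height_apply ▸ frequently_sign_eq c)
    rwa [← hΦ.map_nhds, frequently_map] at h
  have hsnd := signGermEq_snd hcont (hΦ.height_comp_eq_zero_iff hΨ) hfreq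
  rw [← hΦ.symm_apply] at hsnd
  obtain ⟨c, hc⟩ := (hsnd.comp (Φ.symm.continuousAt hΦ.mem_target)).symm
  refine ⟨c, ?_⟩
  filter_upwards [hc, Φ.open_target.mem_nhds hΦ.mem_target] with z hz hzt
  rw [comp_apply, comp_apply, Φ.right_inv hzt] at hz
  exact hz

end Bicollar

section FiberSign

variable {S N : Type*} [TopologicalSpace S] [TopologicalSpace N] {f : S → N}
  {Φ : S → OpenPartialHomeomorph (S × ℝ) N}

theorem frequently_forall_finset {X ι : Type*} [TopologicalSpace X] {s : Finset ι}
    {P : ι → X → Prop} {p : X} (hdense : ∀ i ∈ s, ∀ᶠ z in 𝓝 p, ∃ᶠ w in 𝓝 z, P i w)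
    (hopen : ∀ i ∈ s, ∀ᶠ z in 𝓝 p, P i z → ∀ᶠ w in 𝓝 z, P i w) :
    ∃ᶠ z in 𝓝 p, ∀ i ∈ s, P i z := by
  classical
  induction s using Finset.induction_on with
  | empty => simp
  | insert i s _ ih =>
    simp only [Finset.forall_mem_insert] at hdense hopen ⊢
    have hs := ih hdense.2 hopen.2
    have hopen' := (Finset.eventually_all s).2 hopen.2
    refine frequently_frequently_nhds.1 ?_
    refine (hs.and_eventually (hdense.1.and hopen')).mono fun z ⟨hz, hiz, hzo⟩ => ?_
    exact hiz.and_eventually ((Finset.eventually_all s).2 fun j hj => hzo j hj (hz j hj))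

theorem continuous_of_isBicollarAt (hΦ : ∀ x, IsBicollarAt f (Φ x) x) : Continuous f :=
  continuous_iff_continuousAt.2 fun x => (hΦ x).continuousAt

theorem finite_fiber_of_isBicollarAt [CompactSpace S] [T1Space N]
    (hΦ : ∀ x, IsBicollarAt f (Φ x) x) (p : N) : (f ⁻¹' {p}).Finite := by
  refine (isClosed_singleton.preimage (continuous_of_isBicollarAt hΦ)).isCompact.finite
    (.of_nhdsWithin fun x hx => le_pure_iff.2 (mem_nhdsWithin_iff_eventually.2 ?_))
  filter_upwards [(hΦ x).eventually] with y hy hyp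
  exact hy.eq_of_apply_eq (hΦ x) (hyp.trans hx.symm)

/-- The product, over the sheets of `f` through `p`, of the side of the sheet on which `z` lies. -/
noncomputable def fiberSign (f : S → N) (Φ : S → OpenPartialHomeomorph (S × ℝ) N) (p z : N) :
    SignType :=
  ∏ᶠ x ∈ f ⁻¹' {p}, sign (bicollarHeight (Φ x) z)

theorem eventually_signGermEq_finprod_inter [LocallyConnectedSpace S]
    (hΦ : ∀ x, IsBicollarAt f (Φ x) x) {x : S} {V : Set S} (hVx : V ∈ 𝓝 x)
    (hV : ∀ y ∈ V, IsBicollarAt f (Φ x) y) :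
    ∀ᶠ q in 𝓝 (f x), SignGermEq (fun z => sign (bicollarHeight (Φ x) z))
      (fun z => ∏ᶠ y ∈ f ⁻¹' {q} ∩ V, sign (bicollarHeight (Φ y) z)) q := by
  filter_upwards [(hΦ x).mem_image_of_height_eq_zero hVx,
    (Φ x).open_target.mem_nhds (hΦ x).mem_target] with q hq hqt
  by_cases h0 : bicollarHeight (Φ x) q = 0
  · obtain ⟨y, hyV, rfl⟩ := hq h0
    have hsingle : f ⁻¹' {f y} ∩ V = {y} := eq_singleton_iff_unique_mem.2
      ⟨⟨rfl, hyV⟩, fun y' hy' => (hV y' hy'.2).eq_of_apply_eq (hV y hyV) hy'.1⟩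
    simpa only [hsingle, finprod_mem_singleton] using (hV y hyV).signGermEq (hΦ y)
  · have hempty : f ⁻¹' {q} ∩ V = ∅ := eq_empty_of_forall_notMem fun y hy =>
      h0 (hy.1 ▸ (hV y hy.2).height_apply)
    simpa only [hempty, finprod_mem_empty] using
      signGermEq_one_of_continuousAt (continuousAt_bicollarHeight hqt) h0

theorem eventually_fiberSign_signGermEq [CompactSpace S] [T2Space S] [LocallyConnectedSpace S]
    [T2Space N] (hΦ : ∀ x, IsBicollarAt f (Φ x) x) (p : N) :
    ∀ᶠ q in 𝓝 p, SignGermEq (fiberSign f Φ p) (fiberSign f Φ q) q := by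
  have hfin := finite_fiber_of_isBicollarAt hΦ
  obtain ⟨W, hW, hdisj⟩ := (hfin p).t2_separation
  let V (x : S) : Set S := W x ∩ {y | IsBicollarAt f (Φ x) y}
  have hVx (x : S) : V x ∈ 𝓝 x := inter_mem ((hW x).2.mem_nhds (hW x).1) (hΦ x).eventually
  have hcover : ∀ᶠ q in 𝓝 p, ∀ y ∈ f ⁻¹' {q}, y ∈ ⋃ x ∈ f ⁻¹' {p}, V x :=
    (continuous_of_isBicollarAt hΦ).isClosedMap.eventually_nhds_fiber p fun x hx =>
      mem_of_superset (hVx x) (subset_biUnion_of_mem (u := V) hx)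
  have hsheet : ∀ᶠ q in 𝓝 p, ∀ x ∈ (hfin p).toFinset,
      SignGermEq (fun z => sign (bicollarHeight (Φ x) z))
        (fun z => ∏ᶠ y ∈ f ⁻¹' {q} ∩ V x, sign (bicollarHeight (Φ y) z)) q := by
    refine (Finset.eventually_all _).2 fun x hx => ?_
    rw [← (hfin p).mem_toFinset.1 hx]
    exact eventually_signGermEq_finprod_inter hΦ (hVx x) fun y hy => hy.2
  filter_upwards [hcover, hsheet] with q hq hqs
  have hsplit (z : N) : fiberSign f Φ q z =
      ∏ x ∈ (hfin p).toFinset, ∏ᶠ y ∈ f ⁻¹' {q} ∩ V x, sign (bicollarHeight (Φ y) z) := by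
    rw [← finprod_mem_eq_finite_toFinset_prod _ (hfin p), ← finprod_mem_biUnion _ (hfin p)
      fun x _ => (hfin q).inter_of_left _, ← inter_iUnion₂, inter_eq_left.2 hq, fiberSign]
    exact hdisj.mono_on fun x _ => inter_subset_right.trans inter_subset_left
  have hp (z : N) : fiberSign f Φ p z =
      ∏ x ∈ (hfin p).toFinset, sign (bicollarHeight (Φ x) z) :=
    finprod_mem_eq_finite_toFinset_prod _ (hfin p)
  simpa only [funext hsplit, funext hp] using SignGermEq.prod hqs

theorem frequently_fiberSign_ne_zero [CompactSpace S] [T1Space N]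
    (hΦ : ∀ x, IsBicollarAt f (Φ x) x) (p : N) : ∃ᶠ z in 𝓝 p, fiberSign f Φ p z ≠ 0 := by
  have hfin := finite_fiber_of_isBicollarAt hΦ p
  have htarget (x : S) (hx : x ∈ hfin.toFinset) : ∀ᶠ z in 𝓝 p, z ∈ (Φ x).target := by
    rw [← hfin.mem_toFinset.1 hx]
    exact (Φ x).open_target.mem_nhds (hΦ x).mem_target
  have hne : ∃ᶠ z in 𝓝 p, ∀ x ∈ hfin.toFinset, bicollarHeight (Φ x) z ≠ 0 :=
    frequently_forall_finset
      (fun x hx => (htarget x hx).mono fun z hz =>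
        frequently_bicollarHeight hz (mem_closure_iff_frequently.1 (dense_compl_singleton 0 _)))
      fun x hx => (htarget x hx).mono fun z hz h0 =>
        (continuousAt_bicollarHeight hz).eventually_ne h0
  refine hne.mono fun z hz => ?_
  rw [fiberSign, finprod_mem_eq_finite_toFinset_prod _ hfin]
  exact Finset.prod_ne_zero_iff.2 fun x hx => sign_ne_zero.2 (hz x hx)

theorem isSignSystem_fiberSign [CompactSpace S] [T2Space S] [LocallyConnectedSpace S]
    [T2Space N] (hΦ : ∀ x, IsBicollarAt f (Φ x) x) : IsSignSystem (fiberSign f Φ) :=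
  ⟨eventually_fiberSign_signGermEq hΦ, frequently_fiberSign_ne_zero hΦ⟩

end FiberSign

section Crossings

variable {S N : Type*} {γ : ℝ → N} {f : S → N} {c : ℝ}

/-- The pairs of a parameter in the period `[0, c)` of the closed curve `γ` and a point of `S` with
the same image in `N`. -/
def crossingPairs (γ : ℝ → N) (f : S → N) (c : ℝ) : Set (ℝ × S) :=
  {p | p.1 ∈ Ico 0 c ∧ γ p.1 = f p.2}

theorem image_crossingPairs (hc : 0 < c) (hγ : Periodic γ c) (f : S → N) :
    (fun p : ℝ × S => f p.2) '' crossingPairs γ f c = range γ ∩ range f := by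
  ext z
  constructor
  · rintro ⟨p, hp, rfl⟩
    exact ⟨⟨p.1, hp.2⟩, p.2, rfl⟩
  · rintro ⟨⟨t, rfl⟩, x, hx⟩
    obtain ⟨t', ht', h⟩ := hγ.exists_mem_Ico₀ hc t
    exact ⟨(t', x), ⟨ht', h.symm.trans hx.symm⟩, hx⟩

theorem apply_eq_of_modEq (hγ : Periodic γ c) {s t : ℝ} (h : s ≡ t [PMOD c]) : γ s = γ t := by
  obtain ⟨n, hn⟩ := AddCommGroup.modEq_iff_zsmul.1 h
  rw [← hγ.zsmul n s, hn, add_sub_cancel]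

open scoped Classical in
theorem prod_fiber_eq_prod_crossingPairs {M : Type*} [CommMonoid M] (hc : 0 < c)
    (hγ : Periodic γ c) (hpairs : (crossingPairs γ f c).Finite) (t : ℝ)
    (hfiber : (f ⁻¹' {γ t}).Finite) (u : M) :
    ∏ _x ∈ hfiber.toFinset, u = ∏ p ∈ hpairs.toFinset, if t ≡ p.1 [PMOD c] then u else 1 := by
  have hmod : t ≡ toIcoMod hc 0 t [PMOD c] := (toIcoMod_inj hc).1 (toIcoMod_toIcoMod hc 0 0 t).symm
  rw [← Finset.prod_filter]
  refine Finset.prod_nbij' (fun x => (toIcoMod hc 0 t, x)) Prod.snd ?_ ?_ (fun _ _ => rfl) ?_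
    fun _ _ => rfl
  · intro x hx
    rw [Finset.mem_filter, hpairs.mem_toFinset]
    exact ⟨⟨toIcoMod_mem_Ico' hc t, (apply_eq_of_modEq hγ hmod.symm).trans
      (hfiber.mem_toFinset.1 hx).symm⟩, hmod⟩
  · intro p hp
    rw [Finset.mem_filter, hpairs.mem_toFinset] at hp
    exact hfiber.mem_toFinset.2 (hp.1.2.symm.trans (apply_eq_of_modEq hγ hp.2.symm))
  · intro p hp
    rw [Finset.mem_filter, hpairs.mem_toFinset] at hp
    refine Prod.ext ?_ rfl
    rw [(toIcoMod_inj hc).2 hp.2, (toIcoMod_eq_self hc).2 (by simpa only [zero_add] using hp.1.1)]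

variable [TopologicalSpace S] [TopologicalSpace N] {Φ : S → OpenPartialHomeomorph (S × ℝ) N}

theorem eventually_eq_of_signGermEq_sub (hΦ : ∀ x, IsBicollarAt f (Φ x) x) {t : ℝ} {x : S}
    (htx : γ t = f x)
    (hcross : SignGermEq (fun s => sign (bicollarHeight (Φ x) (γ s))) (fun s => sign (s - t)) t) :
    ∀ᶠ p : ℝ × S in 𝓝 (t, x), γ p.1 = f p.2 → p = (t, x) := by
  obtain ⟨e, he⟩ := hcross
  rw [nhds_prod_eq]
  filter_upwards [he.prod_mk (hΦ x).eventually] with p ⟨hs, hy⟩ hp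
  rw [hp, hy.height_apply, sign_zero, eq_comm, mul_eq_zero, or_iff_right e.ne_zero,
    sign_eq_zero_iff, sub_eq_zero] at hs
  exact Prod.ext hs (hy.eq_of_apply_eq (hΦ x) (by rw [← hp, hs, htx]))

variable [CompactSpace S] [T2Space N]

theorem finite_crossingPairs (hΦ : ∀ x, IsBicollarAt f (Φ x) x) (hγ : Continuous γ)
    (hcross : ∀ t x, γ t = f x →
      SignGermEq (fun s => sign (bicollarHeight (Φ x) (γ s))) (fun s => sign (s - t)) t) :
    (crossingPairs γ f c).Finite := by
  have hf := continuous_of_isBicollarAt hΦ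
  have hclosed : IsClosed {p : ℝ × S | γ p.1 = f p.2} :=
    isClosed_eq (hγ.comp continuous_fst) (hf.comp continuous_snd)
  have hcompact : IsCompact (Icc 0 c ×ˢ univ ∩ {p : ℝ × S | γ p.1 = f p.2}) :=
    (isCompact_Icc.prod isCompact_univ).inter_right hclosed
  refine (hcompact.finite (.of_nhdsWithin fun p hp => ?_)).subset
    fun p hp => ⟨⟨Ico_subset_Icc_self hp.1, mem_univ _⟩, hp.2⟩
  refine le_pure_iff.2 (mem_nhdsWithin_iff_eventually.2 ?_)
  filter_upwards [eventually_eq_of_signGermEq_sub hΦ hp.2 (hcross _ _ hp.2)] with q hq hqp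
  exact hq hqp.2

theorem even_ncard_crossingPairs [T2Space S] [LocallyConnectedSpace S] [SimplyConnectedSpace N]
    [LocallyPathConnectedSpace N] (hΦ : ∀ x, IsBicollarAt f (Φ x) x) (hγ : Continuous γ)
    (hc : 0 < c) (hγc : Periodic γ c)
    (hcross : ∀ t x, γ t = f x →
      SignGermEq (fun s => sign (bicollarHeight (Φ x) (γ s))) (fun s => sign (s - t)) t) :
    Even (crossingPairs γ f c).ncard := by
  obtain ⟨s, hs⟩ := (isSignSystem_fiberSign hΦ).exists_signGermEq
  have hpairs := finite_crossingPairs (c := c) hΦ hγ hcross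
  rw [ncard_eq_toFinset_card _ hpairs]
  refine even_card_of_periodic_of_signGermEq hc.ne' (hγc.comp s) _ Prod.fst fun t => ?_
  have hfiber := finite_fiber_of_isBicollarAt hΦ (γ t)
  have hprod : SignGermEq (fiberSign f Φ (γ t) ∘ γ)
      (fun r => ∏ _x ∈ hfiber.toFinset, sign (r - t)) t := by
    have hfs : fiberSign f Φ (γ t) ∘ γ =
        fun r => ∏ x ∈ hfiber.toFinset, sign (bicollarHeight (Φ x) (γ r)) :=
      funext fun r => finprod_mem_eq_finite_toFinset_prod _ hfiber
    rw [hfs]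
    exact SignGermEq.prod fun x hx => hcross t x (hfiber.mem_toFinset.1 hx).symm
  simp only [prod_fiber_eq_prod_crossingPairs hc hγc hpairs] at hprod
  exact ((hs (γ t)).comp hγ.continuousAt).trans hprod

end Crossings

theorem apply_ne_zero_of_span_sup_range_eq_top {R V W P : Type*} [Ring R] [AddCommGroup V]
    [AddCommGroup W] [AddCommGroup P] [Module R V] [Module R W] [Module R P] {D : V →ₗ[R] P}
    {A : W →ₗ[R] V} {v : V} (hD : D ≠ 0) (hDA : D ∘ₗ A = 0)
    (htop : Submodule.span R {v} ⊔ LinearMap.range A = ⊤) : D v ≠ 0 := fun hv =>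
  hD (LinearMap.ker_eq_top.1 (top_le_iff.1 (htop.symm.le.trans (sup_le
    ((Submodule.span_singleton_le_iff_mem _ _).2 hv) (LinearMap.range_le_ker_iff.2 hDA)))))

section SmoothBicollar

variable {E E' H H' M N : Type*} [NormedAddCommGroup E] [NormedSpace ℝ E]
  [NormedAddCommGroup E'] [NormedSpace ℝ E'] [TopologicalSpace H] [TopologicalSpace H']
  {I : ModelWithCorners ℝ E H} {J : ModelWithCorners ℝ E' H'} [TopologicalSpace M]
  [ChartedSpace H M] [TopologicalSpace N] [ChartedSpace H' N] {n : ℕ∞ω} {f : M → N}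
  {Φ : OpenPartialHomeomorph (M × ℝ) N} {x : M}

variable (J) in
/-- A bicollar which is regular at `f x`: the height is differentiable there, and so is the fibre
`r ↦ Φ (x, r)`, along which the height is `r`. -/
structure IsRegularBicollarAt (f : M → N) (Φ : OpenPartialHomeomorph (M × ℝ) N) (x : M) : Prop
    extends IsBicollarAt f Φ x where
  mdifferentiableAt_height : MDifferentiableAt J 𝓘(ℝ, ℝ) (bicollarHeight Φ) (f x)
  mdifferentiableAt_fiber : MDifferentiableAt 𝓘(ℝ, ℝ) J (fun r => Φ (x, r)) 0

theorem exists_isRegularBicollarAt [I.Boundaryless] [J.Boundaryless] [IsManifold J n N]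
    (hn : n ≠ 0) (h : IsImmersionAtOfComplement ℝ I J n f x) :
    ∃ Φ, IsRegularBicollarAt J f Φ x := by
  let a := h.domChart.transHomeomorph I.toHomeomorph
  let b := h.codChart.transHomeomorph
    (J.toHomeomorph.trans h.equiv.symm.toHomeomorph)
  have hb : ∀ y ∈ h.domChart.source, b (f y) = (a y, 0) := fun y hy => by
    have hw := h.writtenInCharts ((h.domChart.extend I).map_source
      (by rwa [OpenPartialHomeomorph.extend_source]))
    rw [comp_apply, comp_apply, OpenPartialHomeomorph.extend_left_inv _ hy] at hw
    exact (h.equiv.symm_apply_eq).2 hw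
  have hx : b (f x) = (a x, 0) := hb x h.mem_domChart_source
  have hxt : (a x, 0) ∈ b.target := hx ▸ b.map_source h.mem_codChart_source
  refine ⟨(a.prod (.refl ℝ)).trans b.symm, ⟨⟨⟨h.mem_domChart_source, mem_univ _⟩, hxt⟩, ?_⟩, ?_, ?_⟩
  · rintro y ⟨⟨hy, -⟩, -⟩
    change b.symm (a y, 0) = f y
    rw [← hb y hy, b.left_inv (h.source_subset_preimage_source hy)]
  · have hd := (h.codChart.contMDiffAt_extend h.codChart_mem_maximalAtlas
      h.mem_codChart_source).mdifferentiableAt hn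
    exact ((ContinuousLinearMap.snd ℝ E ℝ).comp
      h.equiv.symm.toContinuousLinearMap).mdifferentiableAt.comp _ hd
  · have hmem : J '' h.codChart.target ∈ 𝓝 (h.equiv (a x, 0)) := by
      rw [← (h.equiv.symm_apply_eq).1 hx]
      exact (J.toHomeomorph.isOpenMap _ h.codChart.open_target).mem_nhds
        (mem_image_of_mem J (h.codChart.map_source h.mem_codChart_source))
    have hd := ((contMDiffOn_extend_symm h.codChart_mem_maximalAtlas).contMDiffAt
      hmem).mdifferentiableAt hn
    have hline : DifferentiableAt ℝ (fun r : ℝ => h.equiv (a x, r)) 0 := by fun_prop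
    exact MDifferentiableAt.comp (g := (h.codChart.extend J).symm) (0 : ℝ) hd
      hline.mdifferentiableAt

namespace IsRegularBicollarAt

theorem mfderiv_height_ne_zero (hΦ : IsRegularBicollarAt J f Φ x) :
    (mfderiv J 𝓘(ℝ, ℝ) (bicollarHeight Φ) (f x) : E' →L[ℝ] ℝ) ≠ 0 := by
  intro h0
  let D : E' →L[ℝ] ℝ := mfderiv J 𝓘(ℝ, ℝ) (bicollarHeight Φ) (f x)
  have hheight : HasMFDerivAt J 𝓘(ℝ, ℝ) (bicollarHeight Φ) (Φ (x, 0)) D :=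
    (hΦ.apply_zero x hΦ.mem_source).symm ▸ hΦ.mdifferentiableAt_height.hasMFDerivAt
  have hcomp := hheight.comp (0 : ℝ) hΦ.mdifferentiableAt_fiber.hasMFDerivAt
  have hid : bicollarHeight Φ ∘ (fun r => Φ (x, r)) =ᶠ[𝓝 0] id := by
    have hcont : ContinuousAt (fun r : ℝ => (x, r)) 0 := by fun_prop
    filter_upwards [hcont.eventually (Φ.open_source.eventually_mem hΦ.mem_source)] with r hr
    rw [comp_apply, bicollarHeight, Φ.left_inv hr, id]
  have hone : D ((mfderiv 𝓘(ℝ, ℝ) J (fun r => Φ (x, r)) 0 : ℝ →L[ℝ] E') 1) = 1 :=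
    DFunLike.congr_fun (hasMFDerivAt_unique (hcomp.congr_of_eventuallyEq hid.symm)
      (hasMFDerivAt_id (0 : ℝ))) (1 : ℝ)
  exact one_ne_zero (α := ℝ) (hone.symm.trans (DFunLike.congr_fun h0 _))

theorem mfderiv_height_comp_mfderiv (hΦ : IsRegularBicollarAt J f Φ x)
    (hf : MDifferentiableAt I J f x) :
    (mfderiv J 𝓘(ℝ, ℝ) (bicollarHeight Φ) (f x)).comp (mfderiv I J f x) = 0 := by
  have hzero : bicollarHeight Φ ∘ f =ᶠ[𝓝 x] fun _ => 0 :=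
    hΦ.eventually.mono fun y hy => hy.height_apply
  exact hasMFDerivAt_unique ((hΦ.mdifferentiableAt_height.hasMFDerivAt.comp x
    hf.hasMFDerivAt).congr_of_eventuallyEq hzero.symm) (hasMFDerivAt_const 0 x)

end IsRegularBicollarAt

variable (I J) in
/-- Transversality of the curve `γ` and the hypersurface `f : M → N`: wherever they meet, the
velocity of `γ` and the image of the differential of `f` span the tangent space. -/
def CurveTransverseTo (γ : ℝ → N) (f : M → N) : Prop :=
  ∀ (t : ℝ) (x : M), γ t = f x →
    Submodule.span ℝ {(mfderiv 𝓘(ℝ, ℝ) J γ t : ℝ →L[ℝ] E') 1} ⊔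
      LinearMap.range (mfderiv I J f x : E →L[ℝ] E').toLinearMap = ⊤

theorem IsRegularBicollarAt.signGermEq_sub {γ : ℝ → N} {t : ℝ} (hΦ : IsRegularBicollarAt J f Φ x)
    (hf : MDifferentiableAt I J f x) (htrans : CurveTransverseTo I J γ f) (htx : γ t = f x) :
    SignGermEq (fun s => sign (bicollarHeight Φ (γ s))) (fun s => sign (s - t)) t := by
  let D : E' →L[ℝ] ℝ := mfderiv J 𝓘(ℝ, ℝ) (bicollarHeight Φ) (f x)
  have hD : D ((mfderiv 𝓘(ℝ, ℝ) J γ t : ℝ →L[ℝ] E') 1) ≠ 0 :=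
    apply_ne_zero_of_span_sup_range_eq_top (D := D.toLinearMap)
      (ContinuousLinearMap.coe_injective.ne hΦ.mfderiv_height_ne_zero)
      (congrArg ContinuousLinearMap.toLinearMap (hΦ.mfderiv_height_comp_mfderiv hf))
      (htrans t x htx)
  -- The derivative of `γ` is nonzero, hence not the junk value of a non-differentiable map.
  have hγ : MDifferentiableAt 𝓘(ℝ, ℝ) J γ t := by
    by_contra hγ
    rw [mfderiv_zero_of_not_mdifferentiableAt hγ] at hD
    exact hD (map_zero D)
  have hheight : HasMFDerivAt J 𝓘(ℝ, ℝ) (bicollarHeight Φ) (γ t) D :=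
    htx ▸ hΦ.mdifferentiableAt_height.hasMFDerivAt
  have hderiv : HasFDerivAt (bicollarHeight Φ ∘ γ)
      (D.comp (mfderiv 𝓘(ℝ, ℝ) J γ t : ℝ →L[ℝ] E')) t :=
    (hheight.comp t hγ.hasMFDerivAt).hasFDerivAt
  exact signGermEq_sub_of_hasDerivAt hderiv.hasDerivAt
    ((congrArg _ htx).trans hΦ.height_apply) hD

theorem isImmersionOfComplement_real_of_finrank_eq_add_one
    (hEE' : Module.finrank ℝ E' = Module.finrank ℝ E + 1) (hf : IsImmersion I J n f) :
    IsImmersionOfComplement ℝ I J n f := by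
  obtain ⟨F, _, _, h⟩ := hf
  intro x
  have : FiniteDimensional ℝ E' := .of_finrank_pos (hEE' ▸ Nat.succ_pos _)
  have : FiniteDimensional ℝ (E × F) := (h x).equiv.symm.toLinearEquiv.finiteDimensional
  have : FiniteDimensional ℝ E := .of_surjective (LinearMap.fst ℝ E F) Prod.fst_surjective
  have : FiniteDimensional ℝ F := .of_surjective (LinearMap.snd ℝ E F) Prod.snd_surjective
  have hfinrank := (h x).equiv.toLinearEquiv.finrank_eq
  rw [Module.finrank_prod, hEE', add_right_inj] at hfinrank
  exact (h x).trans_F (.ofFinrankEq (by rw [hfinrank, Module.finrank_self]))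

theorem locallyPathConnectedSpace_of_boundaryless (J : ModelWithCorners ℝ E' H') [J.Boundaryless]
    (N : Type*) [TopologicalSpace N] [ChartedSpace H' N] : LocallyPathConnectedSpace N :=
  have := J.toHomeomorph.isOpenEmbedding.locallyPathConnectedSpace
  ChartedSpace.locallyPathConnectedSpace H' N

theorem theorem2_general [I.Boundaryless] [J.Boundaryless] [IsManifold I n M] [IsManifold J n N]
    [CompactSpace M] [T2Space M] [T2Space N] [SimplyConnectedSpace N] (hn : n ≠ 0)
    (hf : IsImmersionOfComplement ℝ I J n f) {γ : ℝ → N} (hγ : Continuous γ) {c : ℝ} (hc : 0 < c)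
    (hγc : Periodic γ c) (htrans : CurveTransverseTo I J γ f) :
    ((crossingPairs γ f c).Finite ∧ Even (crossingPairs γ f c).ncard) ∧
    (InjOn (fun p : ℝ × M => f p.2) (crossingPairs γ f c) →
      (range γ ∩ range f).Finite ∧ Even (range γ ∩ range f).ncard) := by
  have := locallyPathConnectedSpace_of_boundaryless I M
  have := locallyPathConnectedSpace_of_boundaryless J N
  choose Φ hΦ using fun x => exists_isRegularBicollarAt hn (hf x)
  have hΦ' := fun x => (hΦ x).toIsBicollarAt
  have hcross := fun t x => (hΦ x).signGermEq_sub (t := t)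
    (hf.contMDiff.mdifferentiableAt hn) htrans
  have hfin := finite_crossingPairs (c := c) hΦ' hγ hcross
  have heven := even_ncard_crossingPairs hΦ' hγ hc hγc hcross
  refine ⟨⟨hfin, heven⟩, fun hinj => ?_⟩
  rw [← image_crossingPairs hc hγc f]
  exact ⟨hfin.image _, hinj.ncard_image.symm ▸ heven⟩

end SmoothBicollar

theorem CurveTransverse.curveTransverseTo {S : Type*} [TopologicalSpace S]
    [ChartedSpace (EuclideanSpace ℝ (Fin 2)) S] {γ : ℝ → EuclideanSpace ℝ (Fin 3)}
    {f : S → EuclideanSpace ℝ (Fin 3)} (h : CurveTransverse γ f) :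
    CurveTransverseTo (𝓡 2) 𝓘(ℝ, EuclideanSpace ℝ (Fin 3)) γ f := fun t x htx => by
  rw [mfderiv_eq_fderiv]
  exact h t x htx

theorem theorem2 {S : Type*} [TopologicalSpace S] [ChartedSpace (EuclideanSpace ℝ (Fin 2)) S]
    [IsManifold (𝓡 2) ∞ S] [CompactSpace S] [T2Space S]
    (f : S → EuclideanSpace ℝ (Fin 3))
    (hf : IsImmersion (𝓡 2) 𝓘(ℝ, EuclideanSpace ℝ (Fin 3)) ∞ f)
    (γ : ℝ → EuclideanSpace ℝ (Fin 3)) (hγ : IsSmoothClosedCurve γ)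
    (htrans : CurveTransverse γ f) :
    ((intersectionPairs γ f).Finite ∧ Even (intersectionPairs γ f).ncard) ∧
    (InjOn (fun p : ℝ × S => f p.2) (intersectionPairs γ f) →
      (range γ ∩ range f).Finite ∧ Even (range γ ∩ range f).ncard) :=
  theorem2_general (by simp)
    (isImmersionOfComplement_real_of_finrank_eq_add_one (by simp) hf) hγ.contDiff.continuous
    one_pos hγ.periodic htrans.curveTransverseTo
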